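/- Let $\alpha\ge 2\pi$ be real and $a\in(0,1]$. Let $$\gamma_\alpha(a)=\lim_{m\to\infty}\left(\sum_{r=0}^{m}\frac{\log^\alpha(r+a)}{r+a}-\frac{\log^{\alpha+1}(m+a)}{\alpha+1}\right)$$ be the fractional Stieltjes constant (powers of negative numbers are principal complex powers, $0^\alpha=0$), and set $C_\alpha(a)=\gamma_\alpha(a)-\frac{\log^\alpha a}{a}$. Let $W_0$ be the principal branch of the Lambert $W$ function, that is, the inverse of $w\mapsto we^w$ on the set of all $\xi+i\eta$ with $|\eta|<\pi$ and $\xi>-\eta\cot\eta$ (where $-\eta\cot\eta$ is read as $-1$ at $\eta=0$), together with the boundary points with $0\le\eta<\pi$ and $\xi=-\eta\cot\eta$. Put $w(\alpha)=W_0\!\left(\frac{\alpha i}{2\pi}\right)$. Then the limit defining $\gamma_\alpha(a)$ exists and $$|C_\alpha(a)|<\alpha^2+\frac34\,\alpha^2\log\alpha\cdot\left|e^{\alpha\left(\log w(\alpha)-1/w(\alpha)\right)}\right|,$$ where $\log w(\alpha)$ is the principal logarithm. -/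

import Mathlib

open Filter Topology

noncomputable section

/-- The `m`-th approximation to the fractional Stieltjes constant `γ_α(a)`,
`∑_{r=0}^{m} log^α(r+a)/(r+a) - log^{α+1}(m+a)/(α+1)`.
Powers are principal complex powers, because `log a ≤ 0` for `a ∈ (0,1]` and `α` need not be an
integer; all the terms with `r ≥ 1` are real. -/
def stieltjesApprox (α a : ℝ) (m : ℕ) : ℂ :=
  (∑ r ∈ Finset.range (m + 1), (Real.log (r + a) : ℂ) ^ (α : ℂ) / ((r : ℂ) + (a : ℂ)))
    - (Real.log (m + a) : ℂ) ^ ((α : ℂ) + 1) / ((α : ℂ) + 1)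

/-- The fractional Stieltjes constant `γ_α(a)`. -/
def fractionalStieltjes (α a : ℝ) : ℂ :=
  limUnder atTop (stieltjesApprox α a)

/-- `C_α(a) = γ_α(a) - log^α(a)/a`. -/
def stieltjesC (α a : ℝ) : ℂ :=
  fractionalStieltjes α a - (Real.log a : ℂ) ^ (α : ℂ) / (a : ℂ)

/-- The range of the principal branch of the Lambert `W` function: the region of `ξ + iη` with
`|η| < π` and `ξ > -η cot η` (where `-η cot η` is read as its limit `-1` at `η = 0`), together with
the upper half of its boundary curve, including the point `-1`. The boundary points included are
the images of the branch cut `(-∞, -1/e]`. -/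
def lambertW0Range : Set ℂ :=
  {w | (w.im = 0 ∧ -1 ≤ w.re) ∨
    (0 < w.im ∧ w.im < Real.pi ∧ -(w.im * Real.cot w.im) ≤ w.re) ∨
    (-Real.pi < w.im ∧ w.im < 0 ∧ -(w.im * Real.cot w.im) < w.re)}

/-- The principal branch `W_0` of the Lambert `W` function: the inverse of `w ↦ w e^w` on the
range of the principal branch, which that map sends bijectively onto `ℂ`. -/
def lambertW0 : ℂ → ℂ :=
  Function.invFunOn (fun w : ℂ => w * Complex.exp w) lambertW0Range

/-- `w(α) = W_0(α i / (2π))`. -/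
def saddleW (α : ℝ) : ℂ :=
  lambertW0 ((α : ℂ) * Complex.I / (2 * (Real.pi : ℂ)))

end

/-! Write f(x) = log^α x / x. Second-order Euler–Maclaurin summation from x = 1, where f and f' both
vanish, gives C_α(a) = -(1/2) ∫_1^∞ f''(x) B₂({x - a}) dx, and the limit exists because this
integral converges absolutely. In the variable u = log x, expanding the periodic B₂ in cosines with
coefficients 1/(π²k²) and using ζ(2) = π²/6 reduces everything to one bound M, uniform in k ≥ 1, for
the integrals of f'' against exp(2πik e^u): `stieltjes_tendsto_and_norm_le` yields |C_α(a)| ≤ M/12.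

For M, the path [0, ∞) is moved to the segment from 0 to w followed by the horizontal ray w + t
(`norm_integral_fourierKernel_le`). The point w is the critical point of α log u + 2πi e^u, that is,
w e^w = αi/(2π). In the strip 0 ≤ im u ≤ π/2 one has im e^u ≥ 0, so k = 1 is the worst frequency and
one contour serves for all k. There 2πi e^w = -α/w, so the modulus of u^α exp(2πi e^u) at w is S =
|exp(α(log w - 1/w))|. This modulus stays at most max(1, S) on the contour (`saddleModulus_ray_le`,
`saddleModulus_add_le_of_one_le_re`, `saddleModulus_add_le_one`), so M = (α² + 2α + 2) max(1, S)(|w|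
+ 1/2). An elementary comparison, `stieltjes_bound_lt`, finishes. -/

/-! ### Euler–Maclaurin summation and the Fourier expansion of the remainder. -/

section EulerMaclaurin

open MeasureTheory Set

/-- The function `log^α x / x` in the variable `u = log x`. -/
noncomputable def logPowDiv (α u : ℝ) : ℝ := Real.exp (-u) * u ^ α

/-- The derivative of `log^α x / x` in the variable `u = log x`. -/
noncomputable def logPowDivDeriv (α u : ℝ) : ℝ :=
  Real.exp (-2 * u) * (α * u ^ (α - 1) - u ^ α)

/-- The second derivative of `log^α x / x`, times `x`, in the variable `u = log x`. -/
noncomputable def logPowDivKernel (α u : ℝ) : ℝ :=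
  Real.exp (-2 * u) * (α * (α - 1) * u ^ (α - 2) - 3 * α * u ^ (α - 1) + 2 * u ^ α)

lemma hasDerivAt_logPowDiv {α : ℝ} (hα : 2 ≤ α) (u : ℝ) :
    HasDerivAt (logPowDiv α) (logPowDivDeriv α u * Real.exp u) u := by
  have h1 : HasDerivAt (fun u : ℝ => Real.exp (-u)) (-Real.exp (-u)) u := by
    simpa using (hasDerivAt_neg u).exp
  have h2 := Real.hasDerivAt_rpow_const (x := u) (p := α) (Or.inr (by linarith))
  refine (h1.mul h2).congr_deriv ?_
  have : Real.exp (-2 * u) * Real.exp u = Real.exp (-u) := by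
    rw [← Real.exp_add]; ring_nf
  rw [logPowDivDeriv, mul_right_comm, this]; ring

lemma hasDerivAt_logPowDivDeriv {α : ℝ} (hα : 2 ≤ α) (u : ℝ) :
    HasDerivAt (logPowDivDeriv α) (logPowDivKernel α u) u := by
  have h1 : HasDerivAt (fun u : ℝ => Real.exp (-2 * u)) (Real.exp (-2 * u) * (-2)) u := by
    simpa using ((hasDerivAt_id u).const_mul (-2 : ℝ)).exp
  have h2 := Real.hasDerivAt_rpow_const (x := u) (p := α) (Or.inr (by linarith))
  have h3 := Real.hasDerivAt_rpow_const (x := u) (p := α - 1) (Or.inr (by linarith))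
  refine (h1.mul ((h3.const_mul α).sub h2)).congr_deriv ?_
  rw [logPowDivKernel, show α - 1 - 1 = α - 2 by ring]
  simp only [Pi.sub_apply]
  ring

lemma continuous_logPowDivKernel {α : ℝ} (hα : 2 ≤ α) : Continuous (logPowDivKernel α) := by
  have h (p : ℝ) (hp : 0 ≤ p) : Continuous fun u : ℝ => u ^ p :=
    Real.continuous_rpow_const hp
  have h0 := h α (by linarith)
  have h1 := h (α - 1) (by linarith)
  have h2 := h (α - 2) (by linarith)
  unfold logPowDivKernel
  fun_prop

lemma integrableOn_logPowDivKernel {α : ℝ} (hα : 2 ≤ α) :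
    IntegrableOn (logPowDivKernel α) (Ioi 0) := by
  have h (p : ℝ) (hp : 0 ≤ p) : IntegrableOn (fun u : ℝ => u ^ p * Real.exp (-2 * u)) (Ioi 0) := by
    simpa using integrableOn_rpow_mul_exp_neg_mul_rpow (p := 1) (s := p) (b := 2)
      (by linarith) one_pos two_pos
  have := (((h (α - 2) (by linarith)).const_mul (α * (α - 1))).sub
    ((h (α - 1) (by linarith)).const_mul (3 * α))).add ((h α (by linarith)).const_mul 2)
  refine this.congr (ae_of_all _ fun u => ?_)
  simp only [logPowDivKernel, Pi.add_apply, Pi.sub_apply]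
  ring

/-- The `1`-periodic extension of the second Bernoulli polynomial, by its Fourier series. -/
noncomputable def periodicBernoulliTwo (x : ℝ) : ℝ :=
  ∑' k : ℕ, 1 / (k : ℝ) ^ 2 * Real.cos (2 * Real.pi * k * x) / Real.pi ^ 2

lemma periodicBernoulliTwo_eq {x : ℝ} (n : ℕ) (h0 : (n : ℝ) ≤ x) (h1 : x ≤ n + 1) :
    periodicBernoulliTwo x = (x - n) ^ 2 - (x - n) + 1 / 6 := by
  have h := hasSum_one_div_nat_pow_mul_cos one_ne_zero (x := x - n)
    ⟨by linarith, by linarith⟩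
  have h' := (h.div_const (Real.pi ^ 2)).tsum_eq
  have hB : (Polynomial.map (algebraMap ℚ ℝ) (Polynomial.bernoulli (2 * 1))).eval (x - n)
      = (x - n) ^ 2 - (x - n) + 1 / 6 := by
    simp [Polynomial.bernoulli, Finset.sum_range_succ, bernoulli_eq_bernoulli'_of_ne_one]
    ring
  rw [hB] at h'
  have hc (k : ℕ) : Real.cos (2 * Real.pi * k * (x - n)) = Real.cos (2 * Real.pi * k * x) := by
    rw [show 2 * Real.pi * k * (x - n) = 2 * Real.pi * k * x - ((k * n : ℕ) : ℝ) * (2 * Real.pi) by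
      push_cast; ring, Real.cos_sub_nat_mul_two_pi]
  simp only [hc] at h'
  rw [periodicBernoulliTwo]
  simp only [mul_one] at h'
  rw [h']
  have := Real.pi_pos
  norm_num [Nat.factorial]
  field_simp

lemma continuous_periodicBernoulliTwo : Continuous periodicBernoulliTwo := by
  refine continuous_tsum (u := fun k : ℕ => 1 / (k : ℝ) ^ 2 / Real.pi ^ 2) (fun k => by fun_prop)
    (hasSum_zeta_two.summable.div_const _) fun k x => ?_
  rw [norm_div, norm_mul, Real.norm_of_nonneg (by positivity : (0 : ℝ) ≤ 1 / (k : ℝ) ^ 2),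
    Real.norm_of_nonneg (by positivity : (0 : ℝ) ≤ Real.pi ^ 2)]
  gcongr
  exact mul_le_of_le_one_right (by positivity) (Real.abs_cos_le_one _)

/-- Two integrations by parts on one period of B₂, giving the primitive f'·B₂ - f·B₂' + 2∫f. The
endpoints need not fill the period, which lets the first piece start at x = 1 rather than at x = a.
-/
lemma integral_logPowDivKernel_mul_bernoulli {α a c d : ℝ} (hα : 2 ≤ α) (hcd : c ≤ d) (n : ℕ)
    (hc : n + a ≤ Real.exp c) (hd : Real.exp d ≤ n + 1 + a) :
    ∫ u in c..d, logPowDivKernel α u * periodicBernoulliTwo (Real.exp u - a) =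
      (logPowDivDeriv α d * ((Real.exp d - a - n) ^ 2 - (Real.exp d - a - n) + 1 / 6)
        - logPowDiv α d * (2 * (Real.exp d - a - n) - 1) + 2 * d ^ (α + 1) / (α + 1))
      - (logPowDivDeriv α c * ((Real.exp c - a - n) ^ 2 - (Real.exp c - a - n) + 1 / 6)
        - logPowDiv α c * (2 * (Real.exp c - a - n) - 1) + 2 * c ^ (α + 1) / (α + 1)) := by
  have key (u : ℝ) : HasDerivAt (fun u => logPowDivDeriv α u *
        ((Real.exp u - a - n) ^ 2 - (Real.exp u - a - n) + 1 / 6)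
        - logPowDiv α u * (2 * (Real.exp u - a - n) - 1) + 2 * u ^ (α + 1) / (α + 1))
      (logPowDivKernel α u * ((Real.exp u - a - n) ^ 2 - (Real.exp u - a - n) + 1 / 6)) u := by
    have e1 : HasDerivAt (fun u => Real.exp u - a - n) (Real.exp u) u :=
      ((Real.hasDerivAt_exp u).sub_const a).sub_const _
    have h3 := Real.hasDerivAt_rpow_const (x := u) (p := α + 1) (Or.inr (by linarith))
    have := (((hasDerivAt_logPowDivDeriv hα u).mul (((e1.pow 2).sub e1).add_const (1 / 6))).sub
      ((hasDerivAt_logPowDiv hα u).mul ((e1.const_mul 2).sub_const 1))).add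
      ((h3.const_mul 2).div_const (α + 1))
    refine this.congr_deriv ?_
    have hE : Real.exp u * logPowDiv α u = u ^ α := by
      rw [logPowDiv, ← mul_assoc, ← Real.exp_add]; simp
    have : α + 1 ≠ 0 := by linarith
    rw [show α + 1 - 1 = α by ring, mul_div_assoc, mul_div_cancel_left₀ _ this, ← hE]
    simp only [Pi.sub_apply, Pi.pow_apply, Nat.cast_ofNat, Nat.add_one_sub_one, pow_one]
    ring
  have hcont : Continuous fun u =>
      logPowDivKernel α u * ((Real.exp u - a - n) ^ 2 - (Real.exp u - a - n) + 1 / 6) := by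
    have := continuous_logPowDivKernel hα
    fun_prop
  rw [← intervalIntegral.integral_eq_sub_of_hasDerivAt (fun u _ => key u)
    (hcont.intervalIntegrable _ _)]
  refine intervalIntegral.integral_congr fun u hu => ?_
  rw [uIcc_of_le hcd] at hu
  have h1 := Real.exp_le_exp.2 hu.1
  have h2 := Real.exp_le_exp.2 hu.2
  rw [periodicBernoulliTwo_eq n (by linarith) (by linarith)]

lemma sum_logPowDiv_eq {α a : ℝ} (hα : 2 ≤ α) (ha₀ : 0 < a) (ha₁ : a ≤ 1) (m : ℕ) :
    (∑ r ∈ Finset.range (m + 1), logPowDiv α (Real.log (r + 1 + a)))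
      - Real.log (m + 1 + a) ^ (α + 1) / (α + 1) =
    logPowDivDeriv α (Real.log (m + 1 + a)) / 12 + logPowDiv α (Real.log (m + 1 + a)) / 2
      - (∫ u in (0 : ℝ)..Real.log (m + 1 + a),
          logPowDivKernel α u * periodicBernoulliTwo (Real.exp u - a)) / 2 := by
  have hint (c d : ℝ) : IntervalIntegrable
      (fun u => logPowDivKernel α u * periodicBernoulliTwo (Real.exp u - a)) volume c d := by
    have := continuous_logPowDivKernel hα
    have := continuous_periodicBernoulliTwo
    exact Continuous.intervalIntegrable (by fun_prop) _ _
  induction m with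
  | zero =>
    -- The first, partial period runs over 1 ≤ x ≤ 1 + a; it fits in n = 0 because a ≤ 1, and the
    -- boundary terms at u = 0 vanish because α > 1.
    have h := integral_logPowDivKernel_mul_bernoulli (α := α) (a := a) (c := 0)
      (d := Real.log (1 + a)) hα (Real.log_nonneg (by linarith)) 0 (by simpa using ha₁)
      (by rw [Real.exp_log (by linarith)]; simp)
    have z1 : (0 : ℝ) ^ (α - 1) = 0 := Real.zero_rpow (by linarith)
    have z2 : (0 : ℝ) ^ (α + 1) = 0 := Real.zero_rpow (by linarith)
    have z3 : (0 : ℝ) ^ α = 0 := Real.zero_rpow (by linarith)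
    rw [Real.exp_log (by linarith)] at h
    have y1 : logPowDivDeriv α 0 = 0 := by simp [logPowDivDeriv, z1, z3]
    have y2 : logPowDiv α 0 = 0 := by simp [logPowDiv, z3]
    rw [y1, y2, z2] at h
    simp only [zero_add, Finset.range_one, Finset.sum_singleton, Nat.cast_zero]
    rw [h]
    push_cast
    ring
  | succ m ih =>
    have hm : (0 : ℝ) ≤ m := m.cast_nonneg
    have h := integral_logPowDivKernel_mul_bernoulli (α := α) (a := a)
      (c := Real.log (m + 1 + a)) (d := Real.log (m + 1 + 1 + a)) hα
      (Real.log_le_log (by linarith) (by linarith)) (m + 1)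
      (by rw [Real.exp_log (by linarith)]; push_cast; rfl)
      (by rw [Real.exp_log (by linarith)]; push_cast; rfl)
    rw [Real.exp_log (by linarith), Real.exp_log (by linarith)] at h
    push_cast at h ⊢
    rw [Finset.sum_range_succ, ← intervalIntegral.integral_add_adjacent_intervals
      (hint 0 (Real.log (m + 1 + a))) (hint _ (Real.log (m + 1 + 1 + a))), h]
    push_cast
    linear_combination ih

lemma tendsto_rpow_mul_exp_neg {p b : ℝ} (hb : 0 < b) :
    Tendsto (fun u : ℝ => Real.exp (-b * u) * u ^ p) atTop (𝓝 0) := by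
  simpa only [mul_comm] using tendsto_rpow_mul_exp_neg_mul_atTop_nhds_zero p b hb

lemma tendsto_log_natCast_add_atTop (a : ℝ) :
    Tendsto (fun m : ℕ => Real.log (m + 1 + a)) atTop atTop := by
  refine Real.tendsto_log_atTop.comp ?_
  simpa only [add_assoc] using tendsto_atTop_add_const_right atTop (1 + a)
    (tendsto_natCast_atTop_atTop (R := ℝ))

lemma integrableOn_kernel_mul_bernoulli {α : ℝ} (hα : 2 ≤ α) (a : ℝ) :
    IntegrableOn (fun u => logPowDivKernel α u * periodicBernoulliTwo (Real.exp u - a))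
      (Ioi 0) := by
  have hc := continuous_periodicBernoulliTwo
  refine (integrableOn_logPowDivKernel hα).mul_bdd (c := ∑' k : ℕ, 1 / (k : ℝ) ^ 2 / Real.pi ^ 2)
    (Continuous.aestronglyMeasurable (by fun_prop)) (ae_of_all _ fun u => ?_)
  refine tsum_of_norm_bounded (hasSum_zeta_two.summable.div_const _).hasSum fun k => ?_
  rw [norm_div, norm_mul, Real.norm_of_nonneg (by positivity : (0 : ℝ) ≤ 1 / (k : ℝ) ^ 2),
    Real.norm_of_nonneg (by positivity : (0 : ℝ) ≤ Real.pi ^ 2)]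
  gcongr
  exact mul_le_of_le_one_right (by positivity) (Real.abs_cos_le_one _)

lemma tendsto_sum_logPowDiv {α a : ℝ} (hα : 2 ≤ α) (ha₀ : 0 < a) (ha₁ : a ≤ 1) :
    Tendsto (fun m : ℕ => (∑ r ∈ Finset.range (m + 1), logPowDiv α (Real.log (r + 1 + a)))
      - Real.log (m + 1 + a) ^ (α + 1) / (α + 1)) atTop
      (𝓝 (-(∫ u in Ioi (0 : ℝ),
        logPowDivKernel α u * periodicBernoulliTwo (Real.exp u - a)) / 2)) := by
  simp only [sum_logPowDiv_eq hα ha₀ ha₁]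
  have hL := tendsto_log_natCast_add_atTop a
  have h1 : Tendsto (logPowDivDeriv α) atTop (𝓝 0) := by
    have := ((tendsto_rpow_mul_exp_neg (p := α - 1) two_pos).const_mul α).sub
      (tendsto_rpow_mul_exp_neg (p := α) two_pos)
    simp only [mul_zero, sub_zero] at this
    refine this.congr fun u => ?_
    rw [logPowDivDeriv]; ring
  have h2 : Tendsto (logPowDiv α) atTop (𝓝 0) := by
    refine (tendsto_rpow_mul_exp_neg (p := α) one_pos).congr fun u => ?_
    rw [logPowDiv, neg_one_mul]
  have h3 := (intervalIntegral_tendsto_integral_Ioi 0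
    (integrableOn_kernel_mul_bernoulli hα a) hL)
  have := ((((h1.comp hL).div_const 12).add ((h2.comp hL).div_const 2)).sub (h3.div_const 2))
  simpa [neg_div] using this

/-- The shift by a only multiplies the k-th Fourier integral by a number of modulus 1, so M need not
depend on a. Summing M/(π²k²) gives M/6. -/
lemma abs_integral_kernel_mul_bernoulli_le {α a M : ℝ} (hα : 2 ≤ α)
    (hM : ∀ k : ℕ, 1 ≤ k → ‖∫ u in Ioi (0 : ℝ), (logPowDivKernel α u : ℂ) *
      Complex.exp (2 * Real.pi * Complex.I * k * Complex.exp u)‖ ≤ M) :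
    |∫ u in Ioi (0 : ℝ), logPowDivKernel α u * periodicBernoulliTwo (Real.exp u - a)|
      ≤ M / 6 := by
  set F : ℕ → ℝ → ℝ := fun k u => logPowDivKernel α u *
    (1 / (k : ℝ) ^ 2 * Real.cos (2 * Real.pi * k * (Real.exp u - a)) / Real.pi ^ 2) with hF
  have hD := integrableOn_logPowDivKernel hα
  have hDc := continuous_logPowDivKernel hα
  have hbd (k : ℕ) (u : ℝ) : ‖F k u‖ ≤ 1 / (k : ℝ) ^ 2 * (‖logPowDivKernel α u‖ / Real.pi ^ 2) := by
    simp only [hF]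
    rw [norm_mul, norm_div, norm_mul,
      Real.norm_of_nonneg (by positivity : (0 : ℝ) ≤ 1 / (k : ℝ) ^ 2),
      Real.norm_of_nonneg (by positivity : (0 : ℝ) ≤ Real.pi ^ 2)]
    calc _ ≤ ‖logPowDivKernel α u‖ * (1 / (k : ℝ) ^ 2 * 1 / Real.pi ^ 2) := by
          gcongr; exact Real.abs_cos_le_one _
      _ = _ := by ring
  have hFi (k : ℕ) : Integrable (F k) (volume.restrict (Ioi 0)) := by
    refine Integrable.mono' ((hD.norm.div_const (Real.pi ^ 2)).const_mul (1 / (k : ℝ) ^ 2))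
      (Continuous.aestronglyMeasurable (by fun_prop)) (ae_of_all _ (hbd k))
  have hsum : Summable fun k => ∫ u in Ioi (0 : ℝ), ‖F k u‖ := by
    refine Summable.of_nonneg_of_le (fun k => integral_nonneg fun u => norm_nonneg _) (fun k => ?_)
      (hasSum_zeta_two.summable.mul_right
        (∫ u in Ioi (0 : ℝ), ‖logPowDivKernel α u‖ / Real.pi ^ 2))
    rw [← integral_const_mul]
    exact integral_mono (hFi k).norm ((hD.norm.div_const _).const_mul _) (hbd k)
  have hS := hasSum_integral_of_summable_integral_norm hFi hsum
  have hEq : (fun u => logPowDivKernel α u * periodicBernoulliTwo (Real.exp u - a))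
      = fun u => ∑' k, F k u := by
    funext u
    rw [periodicBernoulliTwo, tsum_mul_left]
  rw [hEq, ← hS.tsum_eq]
  have hterm (k : ℕ) : ‖∫ u in Ioi (0 : ℝ), F k u‖ ≤ 1 / (k : ℝ) ^ 2 * (M / Real.pi ^ 2) := by
    rcases Nat.eq_zero_or_pos k with rfl | hk
    -- The series runs over all of ℕ, but 1 / 0 ^ 2 = 0 removes the term k = 0.
    · simp [hF]
    set J := ∫ u in Ioi (0 : ℝ), (logPowDivKernel α u : ℂ) *
      Complex.exp (2 * Real.pi * Complex.I * k * Complex.exp u) with hJ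
    have hi : Integrable (fun u : ℝ => Complex.exp (-(2 * Real.pi * k * a : ℝ) * Complex.I) *
        ((logPowDivKernel α u : ℂ) *
          Complex.exp (2 * Real.pi * Complex.I * k * Complex.exp u)))
        (volume.restrict (Ioi 0)) := by
      refine Integrable.mono' hD.norm (Continuous.aestronglyMeasurable (by fun_prop))
        (ae_of_all _ fun u => ?_)
      have e : (2 * Real.pi * Complex.I * k * Complex.exp u : ℂ)
        = ((2 * Real.pi * k * Real.exp u : ℝ) : ℂ) * Complex.I := by push_cast; ring
      rw [norm_mul, norm_mul, e, ← Complex.ofReal_neg, Complex.norm_exp_ofReal_mul_I,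
        Complex.norm_exp_ofReal_mul_I, Complex.norm_real, mul_one, one_mul]
    have hre : ∫ u in Ioi (0 : ℝ), F k u = 1 / (k : ℝ) ^ 2 / Real.pi ^ 2 *
        (Complex.exp (-(2 * Real.pi * k * a : ℝ) * Complex.I) * J).re := by
      rw [hJ, ← integral_const_mul, ← RCLike.re_eq_complex_re, ← integral_re hi,
        ← integral_const_mul]
      refine integral_congr_ae (ae_of_all _ fun u => ?_)
      have e : Complex.exp (-(2 * Real.pi * k * a : ℝ) * Complex.I) *
        ((logPowDivKernel α u : ℂ) * Complex.exp (2 * Real.pi * Complex.I * k * Complex.exp u))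
        = (logPowDivKernel α u : ℂ) *
          Complex.exp ((2 * Real.pi * k * (Real.exp u - a) : ℝ) * Complex.I) := by
        rw [mul_left_comm, ← Complex.exp_add]
        congr 2
        push_cast
        ring
      simp only [hF]
      rw [e, RCLike.re_eq_complex_re, Complex.re_ofReal_mul, Complex.exp_ofReal_mul_I_re]
      ring
    rw [hre, norm_mul, Real.norm_of_nonneg (by positivity)]
    have h1 : ‖(Complex.exp (-(2 * Real.pi * k * a : ℝ) * Complex.I) * J).re‖ ≤ M := by
      refine (Complex.abs_re_le_norm _).trans ?_
      rw [norm_mul, ← Complex.ofReal_neg, Complex.norm_exp_ofReal_mul_I, one_mul]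
      exact hM k hk
    calc _ ≤ 1 / (k : ℝ) ^ 2 / Real.pi ^ 2 * M := by gcongr
      _ = _ := by ring
  have := tsum_of_norm_bounded (hasSum_zeta_two.mul_right (M / Real.pi ^ 2)) hterm
  refine this.trans (le_of_eq ?_)
  have := Real.pi_pos
  field_simp

/-- The fractional Stieltjes limit exists, and `C_α(a)` is bounded by the Fourier integrals of the
second derivative of `log^α x / x`. -/
theorem stieltjes_tendsto_and_norm_le {α a M : ℝ} (hα : 2 ≤ α) (ha₀ : 0 < a) (ha₁ : a ≤ 1)
    (hM : ∀ k : ℕ, 1 ≤ k → ‖∫ u in Ioi (0 : ℝ), (logPowDivKernel α u : ℂ) *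
      Complex.exp (2 * Real.pi * Complex.I * k * Complex.exp u)‖ ≤ M) :
    Tendsto (stieltjesApprox α a) atTop (𝓝 (fractionalStieltjes α a)) ∧
      ‖stieltjesC α a‖ ≤ M / 12 := by
  set I := ∫ u in Ioi (0 : ℝ), logPowDivKernel α u * periodicBernoulliTwo (Real.exp u - a)
  have hI : |I| ≤ M / 6 := abs_integral_kernel_mul_bernoulli_le hα hM
  -- The term r = 0, the only one whose logarithm may be negative, is exactly what `stieltjesC`
  -- subtracts; the remainder is real.
  have heq (m : ℕ) : stieltjesApprox α a (m + 1) = (Real.log a : ℂ) ^ (α : ℂ) / (a : ℂ) +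
      (((∑ r ∈ Finset.range (m + 1), logPowDiv α (Real.log (r + 1 + a)))
      - Real.log (m + 1 + a) ^ (α + 1) / (α + 1) : ℝ) : ℂ) := by
    have hpos (r : ℕ) : 0 < (r : ℝ) + 1 + a := by positivity
    have hlog (r : ℕ) : 0 ≤ Real.log ((r : ℝ) + 1 + a) :=
      Real.log_nonneg (by have := r.cast_nonneg (α := ℝ); linarith)
    rw [stieltjesApprox, Finset.sum_range_succ']
    push_cast
    rw [Complex.ofReal_cpow (hlog m)]
    have : ∀ r : ℕ, (Real.log ((r : ℝ) + 1 + a) : ℂ) ^ (α : ℂ) / ((r : ℂ) + 1 + a)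
        = (logPowDiv α (Real.log ((r : ℝ) + 1 + a)) : ℂ) := by
      intro r
      rw [logPowDiv, Real.exp_neg, Real.exp_log (hpos r)]
      push_cast
      rw [Complex.ofReal_cpow (hlog r), div_eq_inv_mul]
    simp only [this, zero_add]
    push_cast
    ring
  have hlim : Tendsto (stieltjesApprox α a) atTop
      (𝓝 ((Real.log a : ℂ) ^ (α : ℂ) / (a : ℂ) + ((-I / 2 : ℝ) : ℂ))) := by
    rw [← tendsto_add_atTop_iff_nat 1]
    simp only [heq]
    exact ((Complex.continuous_ofReal.tendsto _).comp
      (tendsto_sum_logPowDiv hα ha₀ ha₁)).const_add _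
  have hval : fractionalStieltjes α a = _ := hlim.limUnder_eq
  refine ⟨hval ▸ hlim, ?_⟩
  rw [stieltjesC, hval, add_sub_cancel_left, Complex.norm_real, norm_div, norm_neg,
    Real.norm_eq_abs, Real.norm_two]
  linarith

end EulerMaclaurin

/-! ### Shifting the Fourier integrals into the half strip. -/

section Contour

open MeasureTheory Set

/-- The holomorphic extension to `0 < re u` of the `k`-th Fourier integrand of the second
derivative of `log^α x / x`, in the variable `u = log x`. -/
noncomputable def fourierKernel (α : ℝ) (k : ℕ) (u : ℂ) : ℂ :=
  Complex.exp (-2 * u) * (α * (α - 1) * u ^ ((α - 2 : ℝ) : ℂ) - 3 * α * u ^ ((α - 1 : ℝ) : ℂ)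
    + 2 * u ^ (α : ℂ)) * Complex.exp (2 * Real.pi * Complex.I * k * Complex.exp u)

/-- The modulus of `u ^ α * exp (2πi exp u)`, for `u` in the right half plane. -/
noncomputable def saddleModulus (α : ℝ) (u : ℂ) : ℝ :=
  ‖u‖ ^ α * Real.exp (-(2 * Real.pi * (Complex.exp u).im))

/-- The half strip `0 < re u`, `0 ≤ im u ≤ π / 2`. -/
def halfStrip : Set ℂ := {u | 0 < u.re ∧ 0 ≤ u.im ∧ u.im ≤ Real.pi / 2}

lemma convex_halfStrip : Convex ℝ halfStrip :=
  (convex_halfSpace_re_gt 0).inter ((convex_halfSpace_im_ge 0).inter (convex_halfSpace_im_le _))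

lemma fourierKernel_ofReal {α u : ℝ} (k : ℕ) (hu : 0 < u) :
    fourierKernel α k u = (logPowDivKernel α u : ℂ) *
      Complex.exp (2 * Real.pi * Complex.I * k * Complex.exp u) := by
  rw [fourierKernel, logPowDivKernel]
  push_cast
  rw [Complex.ofReal_cpow hu.le, Complex.ofReal_cpow hu.le, Complex.ofReal_cpow hu.le]
  push_cast
  rfl

lemma differentiableAt_fourierKernel (α : ℝ) (k : ℕ) {u : ℂ} (hu : 0 < u.re) :
    DifferentiableAt ℂ (fourierKernel α k) u := by
  have hs : u ∈ Complex.slitPlane := Or.inl hu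
  have h (p : ℂ) : DifferentiableAt ℂ (fun u : ℂ => u ^ p) u :=
    (hasDerivAt_id u |>.cpow_const hs).differentiableAt
  have h0 := h (α : ℂ)
  have h1 := h ((α - 1 : ℝ) : ℂ)
  have h2 := h ((α - 2 : ℝ) : ℂ)
  unfold fourierKernel
  fun_prop

lemma im_exp_nonneg {u : ℂ} (hu : u ∈ halfStrip) : 0 ≤ (Complex.exp u).im := by
  rw [Complex.exp_im]
  have := Real.sin_nonneg_of_nonneg_of_le_pi hu.2.1 (by linarith [hu.2.2, Real.pi_pos])
  positivity

/-- Absorbs the lower powers u^(α-1) and u^(α-2) of the kernel; the 1 in the maximum covers |u| ≤ 1.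
-/
lemma rpow_mul_le_max_one {x c p α : ℝ} (hx : 0 < x) (hp : 0 ≤ p) (hpα : p ≤ α)
    (hc : c ≤ 1) (hc0 : 0 ≤ c) : x ^ p * c ≤ max 1 (x ^ α * c) := by
  rcases le_total x 1 with h | h
  · exact le_max_of_le_left (mul_le_one₀ (Real.rpow_le_one hx.le h hp) hc0 hc)
  · exact le_max_of_le_right (mul_le_mul_of_nonneg_right (Real.rpow_le_rpow_of_exponent_le h hpα) hc0)

/-- Since im e^u ≥ 0, raising k only shrinks the exponential, so k = 1 dominates. The constant is
the sum of absolute coefficients α(α - 1) + 3α + 2. -/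
lemma norm_fourierKernel_le {α : ℝ} (hα : 2 ≤ α) {k : ℕ} (hk : 1 ≤ k) {u : ℂ}
    (hu : u ∈ halfStrip) :
    ‖fourierKernel α k u‖ ≤
      (α ^ 2 + 2 * α + 2) * (Real.exp (-2 * u.re) * max 1 (saddleModulus α u)) := by
  have hpos : 0 < ‖u‖ := norm_pos_iff.2 fun h => by simpa [h] using hu.1
  have him := im_exp_nonneg hu
  have hpi := Real.pi_pos
  set c := Real.exp (-(2 * Real.pi * (Complex.exp u).im)) with hc
  have hc0 : 0 ≤ c := (Real.exp_pos _).le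
  have hc1 : c ≤ 1 := Real.exp_le_one_iff.2 (by simp only [neg_nonpos]; positivity)
  set m := max 1 (saddleModulus α u) with hm
  have hexp : ‖Complex.exp (2 * Real.pi * Complex.I * k * Complex.exp u)‖ ≤ c := by
    rw [Complex.norm_exp, hc, Real.exp_le_exp]
    have : (2 * Real.pi * Complex.I * k * Complex.exp u : ℂ) =
        ((2 * Real.pi * k : ℝ) : ℂ) * (Complex.I * Complex.exp u) := by push_cast; ring
    rw [this, Complex.re_ofReal_mul, Complex.I_mul_re]
    have hk' : (1 : ℝ) ≤ k := by exact_mod_cast hk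
    have : 2 * Real.pi * (Complex.exp u).im * 1 ≤ 2 * Real.pi * (Complex.exp u).im * k := by gcongr
    linarith
  have hr : ‖Complex.exp (-2 * u)‖ = Real.exp (-2 * u.re) := by
    rw [Complex.norm_exp]; congr 1; simp
  have h0 : ‖u‖ ^ α * c ≤ m := rpow_mul_le_max_one hpos (by linarith) le_rfl hc1 hc0
  have h1 : ‖u‖ ^ (α - 1) * c ≤ m :=
    rpow_mul_le_max_one hpos (by linarith) (by linarith) hc1 hc0
  have h2 : ‖u‖ ^ (α - 2) * c ≤ m :=
    rpow_mul_le_max_one hpos (by linarith) (by linarith) hc1 hc0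
  have hα1 : ‖(α : ℂ)‖ = α := by rw [Complex.norm_real, Real.norm_of_nonneg (by linarith)]
  have hα2 : ‖(α : ℂ) - 1‖ = α - 1 := by
    rw [← Complex.ofReal_one, ← Complex.ofReal_sub, Complex.norm_real,
      Real.norm_of_nonneg (by linarith)]
  have hpoly : ‖(α : ℂ) * (α - 1) * u ^ ((α - 2 : ℝ) : ℂ) - 3 * α * u ^ ((α - 1 : ℝ) : ℂ)
      + 2 * u ^ (α : ℂ)‖ ≤ α * (α - 1) * ‖u‖ ^ (α - 2) + 3 * α * ‖u‖ ^ (α - 1) + 2 * ‖u‖ ^ α := by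
    refine (norm_add_le _ _).trans (add_le_add ((norm_sub_le _ _).trans (le_of_eq ?_))
      (le_of_eq ?_))
    · simp only [norm_mul, Complex.norm_cpow_real, hα1, hα2, Complex.norm_ofNat]
    · simp only [norm_mul, Complex.norm_cpow_real, Complex.norm_ofNat]
  rw [fourierKernel, norm_mul, norm_mul, hr]
  calc _ ≤ Real.exp (-2 * u.re) * (α * (α - 1) * ‖u‖ ^ (α - 2) + 3 * α * ‖u‖ ^ (α - 1)
        + 2 * ‖u‖ ^ α) * c := by
        gcongr
        exact mul_nonneg (Real.exp_pos _).le ((norm_nonneg _).trans hpoly)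
    _ = Real.exp (-2 * u.re) * (α * (α - 1) * (‖u‖ ^ (α - 2) * c)
        + 3 * α * (‖u‖ ^ (α - 1) * c) + 2 * (‖u‖ ^ α * c)) := by ring
    _ ≤ Real.exp (-2 * u.re) * (α * (α - 1) * m + 3 * α * m + 2 * m) := by
        have : 0 ≤ α * (α - 1) := mul_nonneg (by linarith) (by linarith)
        gcongr
    _ = _ := by ring

lemma norm_fourierKernel_le_of_norm_le {α : ℝ} (hα : 2 ≤ α) {k : ℕ} (hk : 1 ≤ k) {u : ℂ}
    (hu : u ∈ halfStrip) {x r : ℝ} (hx : 1 ≤ x) (hux : ‖u‖ ≤ x) (hr : r ≤ u.re) :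
    ‖fourierKernel α k u‖ ≤ (α ^ 2 + 2 * α + 2) * (Real.exp (-2 * r) * x ^ α) := by
  refine (norm_fourierKernel_le hα hk hu).trans ?_
  have h1 : saddleModulus α u ≤ x ^ α := by
    have him := im_exp_nonneg hu
    refine (mul_le_of_le_one_right (by positivity) (Real.exp_le_one_iff.2 ?_)).trans
      (Real.rpow_le_rpow (norm_nonneg _) hux (by linarith))
    have := Real.pi_pos
    simp only [neg_nonpos]
    positivity
  have h2 : max 1 (saddleModulus α u) ≤ x ^ α :=
    max_le (Real.one_le_rpow hx (by linarith)) h1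
  gcongr ?_ * (Real.exp ?_ * ?_)
  linarith

/-- The discs with centre R and radius R exhaust the right half plane, so a primitive on one disc
can serve for a whole truncated contour. -/
lemma eventually_mem_ball_self {u : ℂ} (hu : 0 < u.re) :
    ∀ᶠ R : ℝ in atTop, u ∈ Metric.ball (R : ℂ) R := by
  filter_upwards [eventually_gt_atTop (Complex.normSq u / (2 * u.re)), eventually_gt_atTop 0]
    with R hR hR0
  rw [div_lt_iff₀ (by positivity)] at hR
  rw [mem_ball_iff_norm, ← sq_lt_sq₀ (norm_nonneg _) hR0.le, ← Complex.normSq_eq_norm_sq,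
    Complex.normSq_apply]
  rw [Complex.normSq_apply] at hR
  simp only [Complex.sub_re, Complex.sub_im, Complex.ofReal_re, Complex.ofReal_im]
  nlinarith

lemma re_pos_of_mem_ball_self {u : ℂ} {R : ℝ} (hu : u ∈ Metric.ball (R : ℂ) R) : 0 < u.re := by
  rw [mem_ball_iff_norm] at hu
  have := (abs_le.1 (Complex.abs_re_le_norm (u - R))).1
  simp only [Complex.sub_re, Complex.ofReal_re] at this
  linarith

/-- Shift of a truncated Fourier integral to the path from `0` to `w` to `w + T` to `T`. -/
lemma norm_intervalIntegral_fourierKernel_le {α B T : ℝ} {w : ℂ} (hα : 2 ≤ α) {k : ℕ} (hk : 1 ≤ k)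
    (hw : w ∈ halfStrip) (hB : 1 ≤ B)
    (hray : ∀ s : ℝ, 0 < s → s ≤ 1 → saddleModulus α (s * w) ≤ B)
    (hhor : ∀ t : ℝ, 0 ≤ t → saddleModulus α (w + t) ≤ B) (hT : 1 ≤ T) :
    ‖∫ u in (0 : ℝ)..T, (logPowDivKernel α u : ℂ) *
      Complex.exp (2 * Real.pi * Complex.I * k * Complex.exp u)‖ ≤
    (α ^ 2 + 2 * α + 2) * B * (‖w‖ + 1 / 2) +
      (α ^ 2 + 2 * α + 2) * (Real.exp (-2 * T) * (T + ‖w‖) ^ α) * ‖w‖ := by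
  set Q := α ^ 2 + 2 * α + 2 with hQ
  have hQ0 : 0 < Q := by positivity
  set g : ℝ → ℂ := fun u => (logPowDivKernel α u : ℂ) *
      Complex.exp (2 * Real.pi * Complex.I * k * Complex.exp u) with hg
  have hgc : Continuous g := by
    have := continuous_logPowDivKernel hα
    fun_prop
  have hstrip_real (x : ℝ) (hx : 0 < x) : (x : ℂ) ∈ halfStrip :=
    ⟨by simpa, by simp, by simpa using by positivity⟩
  have hstrip_smul (s : ℝ) (h0 : 0 < s) (h1 : s ≤ 1) : (s : ℂ) * w ∈ halfStrip := by
    refine ⟨by simpa using mul_pos h0 hw.1, by simpa using mul_nonneg h0.le hw.2.1, ?_⟩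
    simpa using (mul_le_of_le_one_left hw.2.1 h1).trans hw.2.2
  have hstrip_add (t : ℝ) (h0 : 0 ≤ t) : w + t ∈ halfStrip :=
    ⟨by simpa using by linarith [hw.1], by simpa using hw.2.1, by simpa using hw.2.2⟩
  -- The estimate with a cut-off `ε` at the origin.
  have main (ε : ℝ) (hε : 0 < ε) (hε1 : ε ≤ 1) (hεw : ε * ‖w‖ ≤ 1) :
      ‖∫ u in (0 : ℝ)..T, g u‖ ≤ Q * B * (‖w‖ + 1 / 2) +
        Q * (Real.exp (-2 * T) * (T + ‖w‖) ^ α) * ‖w‖ + ε * (Q + Q * (‖w‖ + 1)) := by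
    -- One disc containing all five vertices contains the path by convexity. With a primitive `G`
    -- there, each side is an increment of `G`, estimated by the mean value inequality.
    obtain ⟨R, h1, h2, h3, h4, h5⟩ := ((eventually_mem_ball_self (u := (ε : ℂ)) (by simpa)).and
      ((eventually_mem_ball_self (hstrip_smul ε hε hε1).1).and
      ((eventually_mem_ball_self hw.1).and
      ((eventually_mem_ball_self (hstrip_add T (by linarith)).1).and
      (eventually_mem_ball_self (u := (T : ℂ)) (by simp; linarith)))))).exists
    have hconv := convex_ball (R : ℂ) R
    obtain ⟨G, hG⟩ := DifferentiableOn.isExactOn_ball (f := fourierKernel α k) (c := (R : ℂ))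
      (r := R) fun u hu =>
        (differentiableAt_fourierKernel α k (re_pos_of_mem_ball_self hu)).differentiableWithinAt
    have seg {p q : ℂ} {C : ℝ} (hp : p ∈ Metric.ball (R : ℂ) R) (hq : q ∈ Metric.ball (R : ℂ) R)
        (hC : ∀ u ∈ segment ℝ p q, ‖fourierKernel α k u‖ ≤ C) : ‖G q - G p‖ ≤ C * ‖q - p‖ :=
      Convex.norm_image_sub_le_of_norm_hasDerivWithin_le
        (fun u hu => (hG u (hconv.segment_subset hp hq hu)).hasDerivWithinAt) hC
        (convex_segment p q) (left_mem_segment ℝ p q) (right_mem_segment ℝ p q)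
    have hfirst : ‖∫ u in (0 : ℝ)..ε, g u‖ ≤ Q * ε := by
      have := intervalIntegral.norm_integral_le_of_norm_le_const (a := (0 : ℝ)) (b := ε) (f := g)
        (C := Q) fun u hu => by
          rw [uIoc_of_le hε.le] at hu
          simp only [hg]
          rw [← fourierKernel_ofReal k hu.1]
          simpa using norm_fourierKernel_le_of_norm_le hα hk (hstrip_real u hu.1) le_rfl
            (by simpa [abs_of_pos hu.1] using hu.2.trans hε1) (r := 0) (by simpa using hu.1.le)
      simpa [abs_of_pos hε] using this
    have hreal : ∫ u in ε..T, g u = G T - G ε := by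
      refine intervalIntegral.integral_eq_sub_of_hasDerivAt (f := fun x : ℝ => G x) (fun u hu => ?_)
        (hgc.intervalIntegrable _ _)
      rw [uIcc_of_le (by linarith)] at hu
      have hu0 : 0 < u := hε.trans_le hu.1
      have hmem : (u : ℂ) ∈ Metric.ball (R : ℂ) R := by
        refine hconv.segment_subset h1 h5 ?_
        obtain ⟨θ, hθ, rfl⟩ : u ∈ (fun θ => ε + θ • (T - ε)) '' Icc (0 : ℝ) 1 := by
          rw [← segment_eq_image', segment_eq_Icc (hu.1.trans hu.2)]
          exact hu
        rw [segment_eq_image']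
        exact ⟨θ, hθ, by simp⟩
      have := (hG u hmem).comp_ofReal
      rwa [fourierKernel_ofReal k hu0] at this
    have hsmall : ‖G (ε * w) - G ε‖ ≤ Q * (ε * (‖w‖ + 1)) := by
      refine (seg (C := Q) h1 h2 fun u hu => ?_).trans ?_
      · have hus := convex_halfStrip.segment_subset (hstrip_real ε hε) (hstrip_smul ε hε hε1) hu
        have hun : ‖u‖ ≤ 1 := by
          have := (convex_closedBall (0 : ℂ) 1).segment_subset (x := (ε : ℂ)) (y := ε * w)
            (by simpa [abs_of_pos hε]) (by simpa [abs_of_pos hε]) hu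
          simpa using this
        simpa using norm_fourierKernel_le_of_norm_le hα hk hus le_rfl hun (r := 0) hus.1.le
      · gcongr
        calc ‖(ε : ℂ) * w - ε‖ = ‖(ε : ℂ) * (w - 1)‖ := by ring_nf
          _ = ε * ‖w - 1‖ := by rw [norm_mul, Complex.norm_real, Real.norm_of_nonneg hε.le]
          _ ≤ ε * (‖w‖ + 1) := by gcongr; simpa using norm_sub_le w 1
    have hray' : ‖G w - G (ε * w)‖ ≤ Q * B * ‖w‖ := by
      refine (seg (C := Q * B) h2 h3 fun u hu => ?_).trans ?_
      · rw [segment_eq_image'] at hu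
        obtain ⟨θ, hθ, rfl⟩ := hu
        have e : (ε : ℂ) * w + θ • (w - ε * w) = ((ε + θ * (1 - ε) : ℝ) : ℂ) * w := by
          simp only [Complex.real_smul]; push_cast; ring
        have hs0 : 0 < ε + θ * (1 - ε) :=
          add_pos_of_pos_of_nonneg hε (mul_nonneg hθ.1 (by linarith))
        have hs1 : ε + θ * (1 - ε) ≤ 1 := by nlinarith [hθ.2]
        simp only [e]
        have hst := hstrip_smul _ hs0 hs1
        refine (norm_fourierKernel_le hα hk hst).trans ?_
        gcongr
        have h := hray _ hs0 hs1
        calc _ ≤ 1 * B := by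
              gcongr
              · exact Real.exp_le_one_iff.2 (by linarith [hst.1])
              · exact max_le hB h
          _ = B := one_mul _
      · gcongr
        calc ‖w - ε * w‖ = ‖((1 - ε : ℝ) : ℂ) * w‖ := by push_cast; ring_nf
          _ = (1 - ε) * ‖w‖ := by
            rw [norm_mul, Complex.norm_real, Real.norm_of_nonneg (by linarith)]
          _ ≤ ‖w‖ := mul_le_of_le_one_left (norm_nonneg _) (by linarith)
    have hhor' : ‖G (w + T) - G w‖ ≤ Q * B * (1 / 2) := by
      have hmem (t : ℝ) (ht : t ∈ Icc 0 T) : w + t ∈ Metric.ball (R : ℂ) R := by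
        refine hconv.segment_subset h3 h4 ?_
        rw [segment_eq_image']
        refine ⟨t / T, ⟨by have := ht.1; positivity, div_le_one_of_le₀ ht.2 (by linarith)⟩, ?_⟩
        have : (T : ℂ) ≠ 0 := by exact_mod_cast (by linarith : T ≠ 0)
        simp only [add_sub_cancel_left, Complex.real_smul, Complex.ofReal_div]
        field_simp
      have hd (t : ℝ) (ht : t ∈ Icc 0 T) :
          HasDerivAt (fun t : ℝ => G (w + t) - G w) (fourierKernel α k (w + t)) t := by
        have h := (hG _ (hmem t ht)).comp_const_add w (t : ℂ)
        exact (h.comp_ofReal).sub_const _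
      -- Comparison function for the horizontal side: keeping the decay e^(-2t) gives total length
      -- 1/2 instead of T.
      have hBd (t : ℝ) : HasDerivAt (fun t : ℝ => Q * B * ((1 - Real.exp (-2 * t)) / 2))
          (Q * B * Real.exp (-2 * t)) t := by
        have h1 : HasDerivAt (fun u : ℝ => Real.exp (-2 * u)) (Real.exp (-2 * t) * (-2)) t := by
          simpa using ((hasDerivAt_id t).const_mul (-2 : ℝ)).exp
        refine (((h1.const_sub 1).div_const 2).const_mul (Q * B)).congr_deriv ?_
        ring
      have := image_norm_le_of_norm_deriv_right_le_deriv_boundary (a := 0) (b := T)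
        (fun t ht => (hd t ht).continuousAt.continuousWithinAt)
        (fun t ht => (hd t (Ico_subset_Icc_self ht)).hasDerivWithinAt) (by simp) hBd
        (fun t ht => by
          have hst := hstrip_add t ht.1
          refine (norm_fourierKernel_le hα hk hst).trans ?_
          have hre : t ≤ (w + t).re := by simpa using hw.1.le
          calc _ ≤ Q * (Real.exp (-2 * t) * B) := by
                gcongr ?_ * (Real.exp ?_ * ?_)
                · linarith
                · exact max_le hB (hhor t ht.1)
            _ = _ := by ring) (right_mem_Icc.2 (by linarith))
      refine this.trans ?_
      have := Real.exp_pos (-2 * T)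
      gcongr
      linarith
    have hvert : ‖G (w + T) - G T‖ ≤ Q * (Real.exp (-2 * T) * (T + ‖w‖) ^ α) * ‖w‖ := by
      have h := seg (C := Q * (Real.exp (-2 * T) * (T + ‖w‖) ^ α)) h5 h4 fun u hu => by
        have hTs := hstrip_real T (by linarith)
        have hus := convex_halfStrip.segment_subset hTs (hstrip_add T (by linarith)) hu
        have hun : ‖u‖ ≤ T + ‖w‖ := by
          have := (convex_closedBall (0 : ℂ) (T + ‖w‖)).segment_subset (x := (T : ℂ)) (y := w + T)
            (by simp [abs_of_pos (by linarith : 0 < T)])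
            (by
              have := norm_add_le w (T : ℂ)
              simp only [Complex.norm_real, Real.norm_of_nonneg (by linarith : 0 ≤ T)] at this
              simpa [add_comm] using this) hu
          simpa using this
        have hre : T ≤ u.re :=
          (convex_halfSpace_re_ge T).segment_subset (x := (T : ℂ)) (y := w + T)
            (by simp) (by simpa using hw.1.le) hu
        exact norm_fourierKernel_le_of_norm_le hα hk hus (by linarith [norm_nonneg w]) hun hre
      simpa using h
    have hsplit : ∫ u in (0 : ℝ)..T, g u = (∫ u in (0 : ℝ)..ε, g u) + ((G (ε * w) - G ε)
        + (G w - G (ε * w)) + (G (w + T) - G w) - (G (w + T) - G T)) := by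
      rw [← intervalIntegral.integral_add_adjacent_intervals (hgc.intervalIntegrable 0 ε)
        (hgc.intervalIntegrable ε T), hreal]
      ring
    rw [hsplit]
    refine (norm_add_le _ _).trans ?_
    have n1 := norm_sub_le ((G (ε * w) - G ε) + (G w - G (ε * w)) + (G (w + T) - G w))
      (G (w + T) - G T)
    have n2 := norm_add₃_le (a := G (ε * w) - G ε) (b := G w - G (ε * w)) (c := G (w + T) - G w)
    linarith
  have hlim : Tendsto (fun ε : ℝ => Q * B * (‖w‖ + 1 / 2) +
        Q * (Real.exp (-2 * T) * (T + ‖w‖) ^ α) * ‖w‖ + ε * (Q + Q * (‖w‖ + 1))) (𝓝[>] 0)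
      (𝓝 (Q * B * (‖w‖ + 1 / 2) + Q * (Real.exp (-2 * T) * (T + ‖w‖) ^ α) * ‖w‖)) := by
    have : Continuous (fun ε : ℝ => Q * B * (‖w‖ + 1 / 2) +
        Q * (Real.exp (-2 * T) * (T + ‖w‖) ^ α) * ‖w‖ + ε * (Q + Q * (‖w‖ + 1))) := by fun_prop
    simpa using (this.tendsto 0).mono_left nhdsWithin_le_nhds
  refine ge_of_tendsto hlim ?_
  have hδ : 0 < 1 / (‖w‖ + 1) := by positivity
  filter_upwards [Ioo_mem_nhdsGT hδ] with ε hε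
  have h := (lt_div_iff₀ (by positivity : 0 < ‖w‖ + 1)).1 hε.2
  have h' := mul_nonneg hε.1.le (norm_nonneg w)
  exact main ε hε.1 (by linarith) (by linarith [hε.1])

theorem norm_integral_fourierKernel_le {α B : ℝ} {w : ℂ} (hα : 2 ≤ α) {k : ℕ} (hk : 1 ≤ k)
    (hw : w ∈ halfStrip) (hB : 1 ≤ B)
    (hray : ∀ s : ℝ, 0 < s → s ≤ 1 → saddleModulus α (s * w) ≤ B)
    (hhor : ∀ t : ℝ, 0 ≤ t → saddleModulus α (w + t) ≤ B) :
    ‖∫ u in Ioi (0 : ℝ), (logPowDivKernel α u : ℂ) *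
      Complex.exp (2 * Real.pi * Complex.I * k * Complex.exp u)‖ ≤
    (α ^ 2 + 2 * α + 2) * B * (‖w‖ + 1 / 2) := by
  have hint : IntegrableOn (fun u : ℝ => (logPowDivKernel α u : ℂ) *
      Complex.exp (2 * Real.pi * Complex.I * k * Complex.exp u)) (Ioi 0) := by
    have := continuous_logPowDivKernel hα
    refine Integrable.mono' (integrableOn_logPowDivKernel hα).norm
      (Continuous.aestronglyMeasurable (by fun_prop)) (ae_of_all _ fun u => ?_)
    have e : (2 * Real.pi * Complex.I * k * Complex.exp u : ℂ)
      = ((2 * Real.pi * k * Real.exp u : ℝ) : ℂ) * Complex.I := by push_cast; ring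
    rw [norm_mul, e, Complex.norm_exp_ofReal_mul_I, Complex.norm_real, mul_one]
  have h1 := (intervalIntegral_tendsto_integral_Ioi 0 hint tendsto_id).norm
  have h2 : Tendsto (fun T : ℝ => Real.exp (-2 * T) * (T + ‖w‖) ^ α) atTop (𝓝 0) := by
    have := ((tendsto_rpow_mul_exp_neg (p := α) two_pos).comp
      (tendsto_atTop_add_const_right atTop ‖w‖ tendsto_id)).const_mul (Real.exp (2 * ‖w‖))
    rw [mul_zero] at this
    refine this.congr fun T => ?_
    simp only [Function.comp, id]
    rw [← mul_assoc, ← Real.exp_add]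
    ring_nf
  have h3 := ((h2.const_mul (α ^ 2 + 2 * α + 2)).mul_const ‖w‖).const_add
    ((α ^ 2 + 2 * α + 2) * B * (‖w‖ + 1 / 2))
  simp only [mul_zero, zero_mul, add_zero] at h3
  refine le_of_tendsto_of_tendsto h1 h3 ?_
  filter_upwards [eventually_ge_atTop 1] with T hT
  exact norm_intervalIntegral_fourierKernel_le hα hk hw hB hray hhor hT

end Contour

/-! ### The saddle point and its polar form. -/

section Saddle

open Set

/-- On the curve w = (M + i) arctan M the argument of w e^w is always π/2, and its modulus is `ψ M`,
which runs from 0 past y; the intermediate value theorem applies. -/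
lemma exists_mul_exp_eq_ofReal_mul_I {y : ℝ} (hy : 0 < y) :
    ∃ w ∈ lambertW0Range, w * Complex.exp w = y * Complex.I := by
  set ψ : ℝ → ℝ := fun M =>
    Real.arctan M * Real.exp (M * Real.arctan M) * Real.sqrt (1 + M ^ 2) with hψ
  have hcont : Continuous ψ := by
    have := Real.continuous_arctan
    fun_prop
  have hend : y ≤ ψ (1 + 2 * y) := by
    have hM : (1 : ℝ) ≤ 1 + 2 * y := by linarith
    have h1 : 1 / 2 ≤ Real.arctan (1 + 2 * y) := by
      have := Real.arctan_strictMono.monotone hM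
      rw [Real.arctan_one] at this
      linarith [Real.pi_gt_three]
    have h2 : 1 ≤ Real.exp ((1 + 2 * y) * Real.arctan (1 + 2 * y)) :=
      Real.one_le_exp (by positivity)
    have h3 : 1 + 2 * y ≤ Real.sqrt (1 + (1 + 2 * y) ^ 2) :=
      Real.le_sqrt_of_sq_le (by linarith)
    calc y ≤ 1 / 2 * 1 * (1 + 2 * y) := by linarith
      _ ≤ _ := by simp only [hψ]; gcongr
  obtain ⟨M, hM, hMy⟩ := intermediate_value_Icc (by linarith : (0 : ℝ) ≤ 1 + 2 * y)
    hcont.continuousOn (⟨by simp [hψ, hy.le], hend⟩ : y ∈ Icc (ψ 0) (ψ (1 + 2 * y)))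
  have hM0 : 0 < M := by
    refine lt_of_le_of_ne hM.1 fun h => ?_
    rw [← h] at hMy
    simp [hψ] at hMy
    exact hy.ne hMy
  set η := Real.arctan M with hη
  have hη0 : 0 < η := Real.arctan_pos.2 hM0
  have hη1 : η < Real.pi / 2 := Real.arctan_lt_pi_div_two M
  have hcos : 0 < Real.cos η := Real.cos_arctan_pos M
  have hsin : 0 < Real.sin η := Real.sin_pos_of_pos_of_lt_pi hη0 (by linarith [Real.pi_pos])
  have hsc : Real.sin η = M * Real.cos η := by
    rw [← Real.tan_arctan M, ← hη, Real.tan_mul_cos hcos.ne']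
  have hsq : Real.sqrt (1 + M ^ 2) = (Real.cos η)⁻¹ := by
    rw [hη, Real.cos_arctan, one_div, inv_inv]
  refine ⟨⟨M * η, η⟩, Or.inr (Or.inl ⟨hη0, by simp only; linarith [Real.pi_pos], ?_⟩), ?_⟩
  · have : 0 ≤ Real.cot η := by rw [Real.cot_eq_cos_div_sin]; positivity
    simp only
    have := mul_nonneg hη0.le this
    have := mul_pos hM0 hη0
    linarith
  · have hMy' : η * Real.exp (M * η) = y * Real.cos η := by
      rw [← hMy]
      simp only [hψ, ← hη, hsq]
      field_simp
    have h2 := Real.sin_sq_add_cos_sq η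
    apply Complex.ext
    · simp only [Complex.mul_re, Complex.exp_re, Complex.exp_im, Complex.ofReal_re, Complex.I_re,
        Complex.ofReal_im, Complex.I_im, hsc]
      ring
    · simp only [Complex.mul_im, Complex.exp_re, Complex.exp_im, Complex.ofReal_re, Complex.I_re,
        Complex.ofReal_im, Complex.I_im]
      have : (M * η * (Real.exp (M * η) * Real.sin η) + η * (Real.exp (M * η) * Real.cos η))
          * Real.cos η = (y * 1 + 0 * 0) * Real.cos η := by
        have e : M * Real.cos η = Real.sin η := hsc.symm
        linear_combination (η * Real.exp (M * η)) * h2 + hMy'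
          + (η * Real.exp (M * η) * Real.sin η) * e
      exact mul_right_cancel₀ hcos.ne' this

/-- The saddle point in polar form: its argument is `π / 2 - im w`. -/
lemma saddleW_spec {α : ℝ} (hα : 0 < α) :
    0 < (saddleW α).im ∧ (saddleW α).im < Real.pi / 2 ∧ 0 < ‖saddleW α‖ ∧
    (saddleW α).re = ‖saddleW α‖ * Real.sin (saddleW α).im ∧
    (saddleW α).im = ‖saddleW α‖ * Real.cos (saddleW α).im ∧
    2 * Real.pi * ‖saddleW α‖ * Real.exp (saddleW α).re = α := by
  have hpi := Real.pi_pos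
  have hy : 0 < α / (2 * Real.pi) := by positivity
  have hz : (α : ℂ) * Complex.I / (2 * (Real.pi : ℂ)) =
      ((α / (2 * Real.pi) : ℝ) : ℂ) * Complex.I := by push_cast; ring
  -- Existence of a preimage is enough: any one in the range satisfies the conclusions, so
  -- injectivity of w e^w is not needed.
  have hex := exists_mul_exp_eq_ofReal_mul_I hy
  have hmem : saddleW α ∈ lambertW0Range := by
    rw [saddleW, lambertW0, hz]
    exact Function.invFunOn_mem hex
  have heq : saddleW α * Complex.exp (saddleW α) =
      ((α / (2 * Real.pi) : ℝ) : ℂ) * Complex.I := by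
    rw [saddleW, lambertW0, hz]
    exact Function.invFunOn_eq hex
  generalize saddleW α = w at hmem heq
  obtain ⟨ξ, η⟩ := w
  have hre := congrArg Complex.re heq
  have him := congrArg Complex.im heq
  simp only [Complex.mul_re, Complex.mul_im, Complex.exp_re, Complex.exp_im, Complex.ofReal_re,
    Complex.I_re, Complex.ofReal_im, Complex.I_im, mul_zero, mul_one, sub_zero,
    add_zero] at hre him
  have hE := Real.exp_pos ξ
  have h2 := Real.sin_sq_add_cos_sq η
  have hre' : ξ * Real.cos η = η * Real.sin η := by
    refine mul_left_cancel₀ hE.ne' ?_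
    linear_combination hre
  have him' : Real.exp ξ * η = α / (2 * Real.pi) * Real.cos η := by
    linear_combination (Real.cos η) * him - (Real.exp ξ * Real.sin η) * hre'
      - (η * Real.exp ξ) * h2
  have hpos : 0 < η ∧ η < Real.pi / 2 := by
    rcases hmem with ⟨h, -⟩ | ⟨h0, h1, -⟩ | ⟨h0, h1, h⟩
    · simp only at h
      rw [h] at him
      simp at him
      exact absurd him.symm (by positivity)
    · simp only at h0 h1
      refine ⟨h0, ?_⟩
      by_contra! hge
      have hc := Real.cos_nonpos_of_pi_div_two_le_of_le hge (by linarith)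
      have := mul_nonpos_of_nonneg_of_nonpos hy.le hc
      have := mul_pos hE h0
      linarith
    -- In the lower half, sin η and cos η are both negative; multiplying ξ > -η cot η by sin η cos η
    -- > 0 turns it into η > 0.
    · simp only at h0 h1 h
      exfalso
      have hc : Real.cos η < 0 := by
        by_contra! hc
        have := mul_nonneg hy.le hc
        have := mul_neg_of_pos_of_neg hE h1
        linarith
      have hs : Real.sin η < 0 := Real.sin_neg_of_neg_of_neg_pi_lt h1 h0
      rw [Real.cot_eq_cos_div_sin] at h
      have hsc : 0 < Real.sin η * Real.cos η := mul_pos_of_neg_of_neg hs hc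
      have h3 := mul_lt_mul_of_pos_right h hsc
      have e : -(η * (Real.cos η / Real.sin η)) * (Real.sin η * Real.cos η)
          = -η * Real.cos η ^ 2 := by
        have := hs.ne
        field_simp
      rw [e, show ξ * (Real.sin η * Real.cos η) = η * Real.sin η ^ 2 by
        linear_combination Real.sin η * hre'] at h3
      nlinarith
  obtain ⟨h0, h1⟩ := hpos
  have hc : 0 < Real.cos η := Real.cos_pos_of_mem_Ioo ⟨by linarith, h1⟩
  have hnorm : ‖(⟨ξ, η⟩ : ℂ)‖ = η / Real.cos η := by
    rw [← Real.sqrt_sq (norm_nonneg _), ← Complex.normSq_eq_norm_sq, Complex.normSq_apply,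
      ← Real.sqrt_sq (by positivity : 0 ≤ η / Real.cos η)]
    congr 1
    field_simp
    linear_combination (ξ * Real.cos η + η * Real.sin η) * hre' + η ^ 2 * h2
  simp only [hnorm]
  refine ⟨h0, h1, by positivity, ?_, by field_simp, ?_⟩
  · field_simp
    exact hre'
  · field_simp at him' ⊢
    linear_combination him'

/-! ### The modulus along the contour, and the numerical comparison. -/

lemma two_pi_mul_im_exp_add {α : ℝ} {w : ℂ} (hρ : 0 < ‖w‖)
    (hα : 2 * Real.pi * ‖w‖ * Real.exp w.re = α) (t : ℝ) :
    2 * Real.pi * (Complex.exp (w + t)).im = α * (Real.exp t * (Real.sin w.im / ‖w‖)) := by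
  rw [Complex.exp_im, ← hα]
  simp only [Complex.add_re, Complex.ofReal_re, Complex.add_im, Complex.ofReal_im, add_zero,
    Real.exp_add]
  field_simp

lemma norm_exp_mul_log_sub_inv {α : ℝ} (hα : 0 < α) :
    ‖Complex.exp ((α : ℂ) * (Complex.log (saddleW α) - 1 / saddleW α))‖
      = saddleModulus α (saddleW α) := by
  obtain ⟨h0, h1, hρ, hre, him, hα'⟩ := saddleW_spec hα
  have h := two_pi_mul_im_exp_add hρ hα' 0
  rw [Complex.ofReal_zero, add_zero, Real.exp_zero, one_mul] at h
  rw [Complex.norm_exp, saddleModulus, Real.rpow_def_of_pos hρ, ← Real.exp_add,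
    Complex.re_ofReal_mul, Complex.sub_re, Complex.log_re, one_div, Complex.inv_re,
    Complex.normSq_eq_norm_sq, h]
  congr 1
  rw [hre]
  field_simp
  ring

/-- The derivative of exp has modulus at most e^(re w) on the segment, so by the saddle equation 2π
im exp drops by at most α(1 - s) from w to sw. The factor s^α ≤ e^(-α(1 - s)) compensates for this.
-/
lemma saddleModulus_ray_le {α : ℝ} {w : ℂ} (hρ : 0 < ‖w‖) (hre : 0 ≤ w.re)
    (hα : 2 * Real.pi * ‖w‖ * Real.exp w.re = α) {s : ℝ} (hs : 0 < s) (hs1 : s ≤ 1) :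
    saddleModulus α (s * w) ≤ saddleModulus α w := by
  have hα0 : 0 < α := by rw [← hα]; have := Real.pi_pos; positivity
  have hmv : ‖Complex.exp w - Complex.exp (s * w)‖ ≤ Real.exp w.re * ‖w - s * w‖ := by
    refine Convex.norm_image_sub_le_of_norm_hasDerivWithin_le (s := {u : ℂ | u.re ≤ w.re})
      (fun u _ => (Complex.hasDerivAt_exp u).hasDerivWithinAt) (fun u hu => ?_)
      (convex_halfSpace_re_le _) ?_ ?_
    · rw [Complex.norm_exp]; exact Real.exp_le_exp.2 hu
    · simpa using mul_le_of_le_one_left hre hs1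
    · simp
  have hn : ‖w - s * w‖ = (1 - s) * ‖w‖ := by
    rw [show w - s * w = ((1 - s : ℝ) : ℂ) * w by push_cast; ring, norm_mul, Complex.norm_real,
      Real.norm_of_nonneg (by linarith)]
  have him : (Complex.exp w).im - (Complex.exp (s * w)).im ≤ Real.exp w.re * ((1 - s) * ‖w‖) := by
    rw [← hn, ← Complex.sub_im]
    exact ((le_abs_self _).trans (Complex.abs_im_le_norm _)).trans hmv
  have h2 : 2 * Real.pi * ((Complex.exp w).im - (Complex.exp (s * w)).im) ≤ α * (1 - s) := by
    have := mul_le_mul_of_nonneg_left him (by positivity : 0 ≤ 2 * Real.pi)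
    refine this.trans (le_of_eq ?_)
    rw [← hα]; ring
  have hlog := mul_le_mul_of_nonneg_left (Real.log_le_sub_one_of_pos hs) hα0.le
  have hns : ‖(s : ℂ) * w‖ = s * ‖w‖ := by
    rw [norm_mul, Complex.norm_real, Real.norm_of_nonneg hs.le]
  rw [saddleModulus, saddleModulus, hns, Real.mul_rpow hs.le hρ.le, mul_comm (s ^ α), mul_assoc]
  gcongr
  rw [Real.rpow_def_of_pos hs, ← Real.exp_add, Real.exp_le_exp]
  linarith

/-- Taking logarithms, log(1 + x) ≤ x bounds the gain from |w + t|, and e^t - 1 ≥ t + t²/2 bounds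
the loss below. The quadratic terms compare as t² ≤ t² re w, which is where re w ≥ 1 enters. -/
lemma saddleModulus_add_le_of_one_le_re {α : ℝ} {w : ℂ} (hρ : 0 < ‖w‖) (hre1 : 1 ≤ w.re)
    (hre : w.re = ‖w‖ * Real.sin w.im)
    (hα : 2 * Real.pi * ‖w‖ * Real.exp w.re = α) {t : ℝ} (ht : 0 ≤ t) :
    saddleModulus α (w + t) ≤ saddleModulus α w := by
  have hα0 : 0 < α := by rw [← hα]; have := Real.pi_pos; positivity
  have h0 := two_pi_mul_im_exp_add hρ hα 0
  rw [Complex.ofReal_zero, add_zero, Real.exp_zero, one_mul] at h0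
  have hsin : Real.sin w.im / ‖w‖ = w.re / ‖w‖ ^ 2 := by rw [hre]; field_simp
  have hsq : ‖w + t‖ ^ 2 = ‖w‖ ^ 2 * (1 + (2 * w.re * t + t ^ 2) / ‖w‖ ^ 2) := by
    rw [mul_add, mul_one, mul_div_cancel₀ _ (by positivity), ← Complex.normSq_eq_norm_sq,
      ← Complex.normSq_eq_norm_sq, Complex.normSq_apply, Complex.normSq_apply]
    simp
    ring
  have hq : 0 ≤ (2 * w.re * t + t ^ 2) / ‖w‖ ^ 2 := by
    have : 0 ≤ w.re := by linarith
    positivity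
  have hpos : 0 < ‖w + t‖ := by
    refine lt_of_le_of_ne (norm_nonneg _) fun h => ?_
    rw [← h] at hsq
    have : 0 < ‖w‖ ^ 2 * (1 + (2 * w.re * t + t ^ 2) / ‖w‖ ^ 2) := by positivity
    simp at hsq
    rcases hsq with h | h
    · exact hρ.ne' (by simp [h])
    · linarith
  have hlog : 2 * Real.log ‖w + t‖ ≤ 2 * Real.log ‖w‖ + (2 * w.re * t + t ^ 2) / ‖w‖ ^ 2 := by
    have e : 2 * Real.log ‖w + t‖ = Real.log (‖w + t‖ ^ 2) := by rw [Real.log_pow]; norm_num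
    have e' : 2 * Real.log ‖w‖ = Real.log (‖w‖ ^ 2) := by rw [Real.log_pow]; norm_num
    rw [e, e', hsq, Real.log_mul (by positivity) (by positivity)]
    have := Real.log_le_sub_one_of_pos
      (by positivity : 0 < 1 + (2 * w.re * t + t ^ 2) / ‖w‖ ^ 2)
    linarith
  have hexp := Real.quadratic_le_exp_of_nonneg ht
  have hfrac : (2 * w.re * t + t ^ 2) / ‖w‖ ^ 2 ≤ 2 * ((Real.exp t - 1) * (w.re / ‖w‖ ^ 2)) := by
    rw [← mul_div_assoc, ← mul_div_assoc]
    gcongr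
    nlinarith
  have hfinal : Real.log ‖w + t‖ ≤ Real.log ‖w‖ + (Real.exp t - 1) * (w.re / ‖w‖ ^ 2) := by
    linarith
  have := mul_le_mul_of_nonneg_left hfinal hα0.le
  rw [saddleModulus, saddleModulus, two_pi_mul_im_exp_add hρ hα t, h0, hsin,
    Real.rpow_def_of_pos hpos, Real.rpow_def_of_pos hρ, ← Real.exp_add, ← Real.exp_add,
    Real.exp_le_exp]
  linarith

/-- For small re w the comparison with S is replaced by one with 1, through log|w + t| ≤ |w + t|/e ≤
(1 + t)/2 ≤ e^t sin(im w)/|w|. It needs |w| ≤ e/2 and sin(im w)/|w| ≥ 1/2. -/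
lemma saddleModulus_add_le_one {α : ℝ} {w : ℂ} (hρ : 0 < ‖w‖) (hre1 : w.re ≤ 1)
    (h0 : 0 < w.im) (h1 : w.im < Real.pi / 2) (hre : w.re = ‖w‖ * Real.sin w.im)
    (him : w.im = ‖w‖ * Real.cos w.im)
    (hα : 2 * Real.pi * ‖w‖ * Real.exp w.re = α) {t : ℝ} (ht : 0 ≤ t) :
    saddleModulus α (w + t) ≤ 1 := by
  have hα0 : 0 < α := by rw [← hα]; have := Real.pi_pos; positivity
  have hsq : ‖w‖ ^ 2 = w.re ^ 2 + w.im ^ 2 := by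
    rw [← Complex.normSq_eq_norm_sq, Complex.normSq_apply]; ring
  -- Here re w = η tan η with η = im w, and 0.88 tan 0.88 already exceeds 1.
  have hη : w.im ≤ 0.88 := by
    by_contra! hlt
    have hs : Real.sin 0.88 ≤ Real.sin w.im :=
      Real.sin_le_sin_of_le_of_le_pi_div_two (by linarith [Real.pi_pos]) h1.le hlt.le
    have hc : Real.cos w.im ≤ Real.cos 0.88 :=
      Real.cos_le_cos_of_nonneg_of_le_pi (by norm_num) (by linarith [Real.pi_pos]) hlt.le
    have b1 := (abs_le.1 (Real.sin_bound (x := 0.88) (by norm_num [abs_of_pos]))).1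
    have b2 := (abs_le.1 (Real.cos_bound (x := 0.88) (by norm_num [abs_of_pos]))).2
    norm_num [abs_of_pos] at b1 b2
    have hrel : w.re * Real.cos w.im = w.im * Real.sin w.im := by
      rw [hre]; nth_rewrite 3 [him]; ring
    have hcpos : 0 < Real.cos w.im :=
      Real.cos_pos_of_mem_Ioo ⟨by linarith, h1⟩
    have e1 : w.re * Real.cos w.im ≤ Real.cos w.im := mul_le_of_le_one_left hcpos.le hre1
    have e2 : 0.88 * 0.735 ≤ w.im * Real.sin w.im := by
      gcongr
      linarith
    norm_num at e2
    linarith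
  have hre0 : 0 ≤ w.re := by
    rw [hre]
    exact mul_nonneg hρ.le (Real.sin_nonneg_of_nonneg_of_le_pi h0.le (by linarith [Real.pi_pos]))
  have hexp1 := Real.exp_one_gt_d9
  have hnorm : ‖w‖ ≤ Real.exp 1 / 2 := by
    refine le_trans (abs_le_of_sq_le_sq' (?_ : ‖w‖ ^ 2 ≤ 1.35 ^ 2) (by norm_num)).2 (by linarith)
    rw [hsq]
    nlinarith
  have hhalf : 1 / 2 ≤ Real.sin w.im / ‖w‖ := by
    have b1 := (abs_le.1 (Real.sin_bound (x := w.im) (by rw [abs_of_pos h0]; linarith))).1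
    rw [abs_of_pos h0] at b1
    have hc := Real.one_sub_sq_div_two_le_cos (x := w.im)
    have hp2 : w.im ^ 2 ≤ 0.88 ^ 2 := by gcongr
    have hp3 : w.im ^ 3 ≤ 0.88 ^ 3 := by gcongr
    norm_num at hp2 hp3
    have b3 : w.im * 0.835 ≤ Real.sin w.im := by
      have := mul_le_mul_of_nonneg_left hp2 h0.le
      have := mul_le_mul_of_nonneg_left hp3 h0.le
      nlinarith
    have b4 : 0.612 ≤ Real.cos w.im := by linarith
    rw [le_div_iff₀ hρ]
    have hcpos : 0 < Real.cos w.im := by linarith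
    refine le_of_mul_le_mul_right ?_ hcpos
    rw [mul_assoc, ← him]
    calc 1 / 2 * w.im ≤ (w.im * 0.835) * 0.612 := by linarith
      _ ≤ _ := by
        gcongr
        exact (by positivity : 0 ≤ w.im * 0.835).trans b3
  have hpos : 0 < ‖w + t‖ := norm_pos_iff.2 fun h => by
    have := congrArg Complex.im h
    simp at this
    linarith
  have hle : ‖w + t‖ ≤ ‖w‖ + t := by
    refine (norm_add_le _ _).trans (le_of_eq ?_)
    rw [Complex.norm_real, Real.norm_of_nonneg ht]
  have hlog : Real.log ‖w + t‖ ≤ ‖w + t‖ / Real.exp 1 := by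
    have := Real.log_le_sub_one_of_pos (div_pos hpos (Real.exp_pos 1))
    rw [Real.log_div hpos.ne' (Real.exp_pos 1).ne', Real.log_exp] at this
    linarith
  have hkey : Real.log ‖w + t‖ ≤ Real.exp t * (Real.sin w.im / ‖w‖) := by
    calc _ ≤ ‖w + t‖ / Real.exp 1 := hlog
      _ ≤ (1 + t) * (1 / 2) := by
        rw [div_le_iff₀ (Real.exp_pos 1)]
        nlinarith
      _ ≤ _ := by
        gcongr
        linarith [Real.add_one_le_exp t]
  have := mul_le_mul_of_nonneg_left hkey hα0.le
  rw [saddleModulus, two_pi_mul_im_exp_add hρ hα t, Real.rpow_def_of_pos hpos, ← Real.exp_add,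
    Real.exp_le_one_iff]
  linarith

/-- For α ≥ 6 the polynomial is at most 1.4α². If ρ ≤ 2, then max(1, S) ≤ 1 + S and 1.4 · 2.5/12 <
3/4. If ρ > 2, the maximum is S, and ρ + 1/2 ≤ 6(1 + ξ) ≤ 6 log α with 1.4 · 6/12 = 0.7 < 3/4. -/
lemma stieltjes_bound_lt {α ρ ξ S : ℝ} (hα6 : 6 ≤ α) (hρ : 0 < ρ)
    (hρξ : ρ ≤ ξ + 2) (hα : 2 * Real.pi * ρ * Real.exp ξ = α) (hS : 0 < S)
    (hS1 : 2 < ρ → 1 ≤ S) :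
    (α ^ 2 + 2 * α + 2) * max 1 S * (ρ + 1 / 2) / 12 < α ^ 2 + 3 / 4 * α ^ 2 * Real.log α * S := by
  have hpi := Real.pi_gt_three
  have hQ : α ^ 2 + 2 * α + 2 ≤ 1.4 * α ^ 2 := by nlinarith
  have hlog1 : 1 ≤ Real.log α := by
    rw [Real.le_log_iff_exp_le (by linarith)]
    linarith [Real.exp_one_lt_d9]
  have hα2 : 0 < α ^ 2 := by positivity
  have hα2S : 0 < α ^ 2 * S := by positivity
  rcases le_or_gt ρ 2 with h | h
  · have hmax : max 1 S ≤ 1 + S := max_le (by linarith) (by linarith)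
    calc _ ≤ (1.4 * α ^ 2) * (1 + S) * (2 + 1 / 2) / 12 := by gcongr
      _ < α ^ 2 + 3 / 4 * α ^ 2 * 1 * S := by nlinarith
      _ ≤ _ := by gcongr
  · have hmax : max 1 S = S := max_eq_right (hS1 h)
    have hlog : 1 + ξ ≤ Real.log α := by
      rw [Real.le_log_iff_exp_le (by linarith), ← hα, Real.exp_add]
      gcongr
      have := Real.exp_one_lt_d9
      nlinarith
    rw [hmax]
    calc _ ≤ (1.4 * α ^ 2) * S * (6 * Real.log α) / 12 := by
          gcongr
          linarith
      _ ≤ 3 / 4 * α ^ 2 * Real.log α * S := by nlinarith [mul_pos hα2S (by linarith : 0 < Real.log α)]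
      _ < _ := by linarith

end Saddle

/-! ### Assembly of the bound. -/

theorem theorem1 (α a : ℝ) (hα : 2 * Real.pi ≤ α) (ha₀ : 0 < a) (ha₁ : a ≤ 1) :
    Tendsto (stieltjesApprox α a) atTop (𝓝 (fractionalStieltjes α a)) ∧
    ‖stieltjesC α a‖ <
      α ^ 2 + 3 / 4 * α ^ 2 * Real.log α *
        ‖Complex.exp ((α : ℂ) * (Complex.log (saddleW α) - 1 / saddleW α))‖ := by
  have hpi := Real.pi_gt_three
  have hα6 : 6 ≤ α := by linarith
  rw [norm_exp_mul_log_sub_inv (by linarith)]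
  obtain ⟨h0, h1, hρ, hre, him, hα'⟩ := saddleW_spec (α := α) (by linarith)
  generalize saddleW α = w at h0 h1 hρ hre him hα' ⊢
  have hre0 : 0 < w.re := by
    rw [hre]
    exact mul_pos hρ (Real.sin_pos_of_pos_of_lt_pi h0 (by linarith))
  have hw : w ∈ halfStrip := ⟨hre0, h0.le, h1.le⟩
  have hS : 0 < saddleModulus α w := mul_pos (Real.rpow_pos_of_pos hρ _) (Real.exp_pos _)
  -- log S = α(log|w| - sin(im w)/|w|), and log 2 > 1/2.
  have hS1 : 2 < ‖w‖ → 1 ≤ saddleModulus α w := fun h => by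
    have hz := two_pi_mul_im_exp_add hρ hα' 0
    rw [Complex.ofReal_zero, add_zero, Real.exp_zero, one_mul] at hz
    rw [saddleModulus, hz, Real.rpow_def_of_pos hρ, ← Real.exp_add, Real.one_le_exp_iff]
    have hl : Real.log 2 ≤ Real.log ‖w‖ := Real.log_le_log two_pos h.le
    have hs : Real.sin w.im / ‖w‖ ≤ 1 / 2 := by
      gcongr
      exact Real.sin_le_one _
    have := mul_le_mul_of_nonneg_left
      (by linarith [Real.log_two_gt_d9] : Real.sin w.im / ‖w‖ ≤ Real.log ‖w‖)
      (by linarith : 0 ≤ α)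
    linarith
  have hρξ : ‖w‖ ≤ w.re + 2 := by
    have := Complex.norm_le_abs_re_add_abs_im w
    rw [abs_of_pos hre0, abs_of_pos h0] at this
    linarith [Real.pi_lt_four]
  have hmain := stieltjes_tendsto_and_norm_le (α := α) (a := a) (by linarith) ha₀ ha₁
    fun k hk => norm_integral_fourierKernel_le (by linarith) hk hw
      (le_max_left 1 (saddleModulus α w))
      (fun s hs hs1 => (saddleModulus_ray_le hρ hre0.le hα' hs hs1).trans (le_max_right _ _))
      (fun t ht => by
        rcases le_total w.re 1 with h | h
        · exact (saddleModulus_add_le_one hρ h h0 h1 hre him hα' ht).trans (le_max_left _ _)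
        · exact (saddleModulus_add_le_of_one_le_re hρ h hre hα' ht).trans (le_max_right _ _))
  exact ⟨hmain.1, hmain.2.trans_lt (stieltjes_bound_lt hα6 hρ hρξ hα' hS hS1)⟩
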